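/- Let $n \ge 0$ be an integer and $[n]=\{1,\dots,n\}$. For a complex $n\times n$ matrix $A$ and $I\subseteq[n]$ let $A_I$ denote the principal minor of $A$ with rows and columns indexed by $I$, where $A_\emptyset = 1$. The affine principal minor map is $$\phi_a:\mathbb{C}^{n\times n}\to\mathbb{C}^{2^n},\qquad A\mapsto (A_I)_{I\subseteq[n]}.$$ Then the image of $\phi_a$ is closed in $\mathbb{C}^{2^n}$, both in the Euclidean topology and in the Zariski topology; that is, it is a Euclidean-closed set and it is the common zero set of a family of polynomials in $2^n$ variables with complex coefficients. -/

import Mathlib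

/-- The affine principal minor map: it sends a complex `n × n` matrix `A` to the vector, indexed by
the subsets `I` of the index set, of the determinants of the submatrices of `A` with rows and
columns in `I`. The minor for `I = ∅` is the determinant of the empty matrix, which is `1`. -/
def affinePrincipalMinorMap (n : ℕ) (A : Matrix (Fin n) (Fin n) ℂ) : Finset (Fin n) → ℂ :=
  fun I => (A.submatrix (Subtype.val : I → Fin n) (Subtype.val : I → Fin n)).det

/-!
The torus of invertible diagonal matrices acts on `n × n` matrices by conjugation, and principal
minors are invariant. If all principal minors of a matrix except the empty one vanish, then its
support digraph has no cycle: a minimal set of vertices without a sink would carry a permutation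
matrix. So every nonconstant invariant monomial lies in the radical of the ideal of these minors,
and by a graded Nakayama argument the ring of invariants is a finite module over the algebra `B`
generated by the principal minors. Since the Reynolds operator retracts the polynomial ring onto the
invariants, a proper ideal of `B` stays proper after extension to the polynomial ring. By the
Nullstellensatz, every point satisfying all relations among the principal minors is then the vector
of principal minors of a matrix.
-/

open MvPolynomial

section SinkFree

variable {α : Type*} {r r' : α → α → Prop} {s : Finset α}

/-- A nonempty finite set of vertices of the digraph `r` in which every vertex has an out-neighbour;
in a finite digraph such a set exists if and only if there is a directed cycle. -/
def IsSinkFree (r : α → α → Prop) (s : Finset α) : Prop :=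
  s.Nonempty ∧ ∀ i ∈ s, ∃ j ∈ s, r i j

theorem IsSinkFree.mono (hs : IsSinkFree r s) (h : ∀ i j, r i j → r' i j) : IsSinkFree r' s :=
  ⟨hs.1, fun i hi => (hs.2 i hi).imp fun j => And.imp_right (h i j)⟩

theorem IsSinkFree.injective_of_minimal (hs : Minimal (IsSinkFree r) s) {g : s → s}
    (hg : ∀ i : s, r i (g i)) : Function.Injective g := by
  classical
  have image_sinkFree : IsSinkFree r (Finset.univ.image fun i => (g i : α)) := by
    refine ⟨(Finset.univ_nonempty_iff.mpr hs.prop.1.to_subtype).image _, fun i hi => ?_⟩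
    obtain ⟨i, -, rfl⟩ := Finset.mem_image.mp hi
    exact ⟨g (g i), Finset.mem_image_of_mem _ (Finset.mem_univ _), hg _⟩
  have subset_image : s ⊆ Finset.univ.image fun i => (g i : α) :=
    hs.le_of_le image_sinkFree (Finset.image_subset_iff.mpr fun i _ => (g i).2)
  refine Finite.injective_iff_surjective.mpr fun j => ?_
  obtain ⟨i, -, hi⟩ := Finset.mem_image.mp (subset_image j.2)
  exact ⟨i, Subtype.ext hi⟩

theorem IsSinkFree.exists_perm_of_minimal (hs : Minimal (IsSinkFree r) s) :
    ∃ σ : Equiv.Perm s, ∀ i j : s, r i j ↔ j = σ i := by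
  classical
  have exists_out (i : s) : ∃ j : s, r i j := by
    obtain ⟨j, hj, hij⟩ := hs.prop.2 i i.2
    exact ⟨⟨j, hj⟩, hij⟩
  choose g hg using exists_out
  have g_inj : Function.Injective g := injective_of_minimal hs hg
  refine ⟨Equiv.ofBijective g (Finite.injective_iff_bijective.mp g_inj), fun i j => ⟨?_, ?_⟩⟩
  · intro hij
    obtain ⟨k, rfl⟩ := Finite.injective_iff_surjective.mp g_inj j
    -- Redirecting `i` to `g k` gives another choice of out-neighbours, which is again injective.
    have update_inj : Function.Injective (Function.update g i (g k)) :=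
      injective_of_minimal hs fun l => by
        rcases eq_or_ne l i with rfl | hl
        · simpa only [Function.update_self] using hij
        · simpa only [Function.update_of_ne hl] using hg l
    by_contra hne
    have hki : k ≠ i := fun h => hne (congrArg g h)
    exact hki (update_inj (by rw [Function.update_of_ne hki, Function.update_self]))
  · rintro rfl
    exact hg i

end SinkFree

section Nakayama

variable {A S : Type*} [CommRing A] [CommRing S]

theorem map_algebraMap_ne_top_of_fg_range [Algebra A S] [FaithfulSMul A S] {π : S →ₗ[A] S}
    (hπ1 : π 1 = 1) (hπ : π.range.FG) {I : Ideal A} (hI : I ≠ ⊤) :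
    I.map (algebraMap A S) ≠ ⊤ := by
  intro htop
  have range_le : π.range ≤ I • π.range := by
    rw [LinearMap.range_eq_map, ← Submodule.map_smul'', Ideal.smul_top_eq_map, htop,
      Submodule.restrictScalars_top]
  obtain ⟨a, haI, ha⟩ :=
    Submodule.exists_sub_one_mem_and_smul_eq_zero_of_fg_of_le_smul I π.range hπ range_le
  have ha0 : a = 0 := by
    have h := ha 1 ⟨1, hπ1⟩
    rwa [Algebra.smul_def, mul_one, FaithfulSMul.algebraMap_eq_zero_iff] at h
  rw [ha0, zero_sub, neg_mem_iff] at haI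
  exact hI (I.eq_top_iff_one.mpr haI)

theorem map_ne_top_of_fg_range {R : Type*} [CommRing R] [Algebra R A] [Algebra R S]
    {φ : A →ₐ[R] S} {π : S →ₗ[φ.range] S} (hπ1 : π 1 = 1) (hπ : π.range.FG) {I : Ideal A}
    (hφI : RingHom.ker φ ≤ I) (hI : I ≠ ⊤) : I.map φ ≠ ⊤ := by
  have ker_le : RingHom.ker (φ.rangeRestrict : A →+* φ.range) ≤ I :=
    (AlgHom.ker_rangeRestrict φ).trans_le hφI
  have map_rangeRestrict_ne_top : I.map (φ.rangeRestrict : A →+* φ.range) ≠ ⊤ :=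
    fun htop => hI ((Ideal.map_eq_top_iff_of_ker_le _ ker_le
      (RingHom.isIntegral_of_surjective _ φ.rangeRestrict_surjective)).mp htop)
  have h := map_algebraMap_ne_top_of_fg_range hπ1 hπ map_rangeRestrict_ne_top
  rwa [Ideal.map_map] at h

end Nakayama

section WeightZero

variable {τ R M : Type*} [CommRing R] [AddCommMonoid M] {w : τ → M}

theorem finite_setOf_monomial_notMem [Finite τ] [IsNoetherianRing R] {J : Ideal (MvPolynomial τ R)}
    (hJ : ∀ m, m ≠ 0 → Finsupp.weight w m = 0 → monomial m 1 ∈ J.radical) :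
    {m | Finsupp.weight w m = 0 ∧ monomial m 1 ∉ J}.Finite := by
  by_contra hinf
  obtain ⟨N, hN⟩ := J.exists_radical_pow_le_of_fg (IsNoetherian.noetherian _)
  -- By Dickson's lemma, infinitely many such exponents contain a chain; its successive quotients
  -- are monomials in the radical, so its terms lie in ever higher powers of the radical.
  let u := Set.Infinite.natEmbedding _ hinf
  obtain ⟨g, hg⟩ := wellQuasiOrdered_le.exists_monotone_subseq fun k => (u k : τ →₀ ℕ)
  have mem_pow (k : ℕ) : monomial (u (g k) : τ →₀ ℕ) 1 ∈ J.radical ^ k := by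
    induction k with
    | zero => simp
    | succ k ih =>
      obtain ⟨c, hc⟩ := exists_add_of_le (hg k (k + 1) k.le_succ)
      have hc0 : c ≠ 0 := by
        rintro rfl
        rw [add_zero] at hc
        exact k.succ_ne_self (g.injective (u.injective (Subtype.ext hc)))
      have hcw : Finsupp.weight w c = 0 := by
        have h := (u (g (k + 1))).2.1
        rwa [hc, map_add, (u (g k)).2.1, zero_add] at h
      have monomial_eq : monomial (u (g (k + 1)) : τ →₀ ℕ) (1 : R) =
          monomial (u (g k) : τ →₀ ℕ) 1 * monomial c 1 := by
        rw [monomial_mul, one_mul, hc]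
      rw [monomial_eq, pow_succ]
      exact Ideal.mul_mem_mul ih (hJ c hc0 hcw)
  exact (u (g N)).2.2 (hN (mem_pow N))

variable (R w) in
/-- The polynomials of weight `0`; for weights that are characters of a torus, these are the
torus-invariant polynomials. -/
def weightZeroSubalgebra : Subalgebra R (MvPolynomial τ R) where
  carrier := {p | IsWeightedHomogeneous w p 0}
  mul_mem' hp hq := by simpa only [Set.mem_ofPred_eq, add_zero] using hp.mul hq
  add_mem' hp hq := hp.add hq
  algebraMap_mem' := isWeightedHomogeneous_C w

variable {B : Subalgebra R (MvPolynomial τ R)}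

theorem weightedHomogeneousComponent_zero_mul {b : MvPolynomial τ R}
    (hb : IsWeightedHomogeneous w b 0) (q : MvPolynomial τ R) :
    weightedHomogeneousComponent w 0 (b * q) = b * weightedHomogeneousComponent w 0 q := by
  classical
  let := weightedGradedAlgebra R w
  have h := DirectSum.coe_decompose_mul_of_left_mem_zero (weightedHomogeneousSubmodule R w)
    (j := 0) (b := q) hb
  rwa [← decompose'_apply R w, ← decompose'_apply R w]

/-- The Reynolds operator: the projection onto the polynomials of weight `0`, as a linear map over a
subalgebra `B` of such polynomials. -/
noncomputable def reynolds (hB : B ≤ weightZeroSubalgebra R w) :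
    MvPolynomial τ R →ₗ[B] MvPolynomial τ R where
  toFun := weightedHomogeneousComponent w 0
  map_add' := map_add _
  map_smul' b q := weightedHomogeneousComponent_zero_mul (hB b.2) q

theorem reynolds_one (hB : B ≤ weightZeroSubalgebra R w) : reynolds hB 1 = 1 :=
  (isWeightedHomogeneous_one R w).weightedHomogeneousComponent_same

theorem homogeneousComponent_weightedHomogeneousComponent_mem_of_mem_span
    {N : Submodule B (MvPolynomial τ R)} {s : Set (MvPolynomial τ R)} {n : ℕ}
    (hB : B ≤ weightZeroSubalgebra R w) (hsB : s ⊆ B)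
    (hs : ∀ p ∈ s, ∃ k, 0 < k ∧ p.IsHomogeneous k)
    (hN : ∀ m, m.degree < n → Finsupp.weight w m = 0 → monomial m 1 ∈ N)
    {q : MvPolynomial τ R} (hq : q ∈ Ideal.span s) :
    homogeneousComponent n (weightedHomogeneousComponent w 0 q) ∈ N := by
  classical
  let π : MvPolynomial τ R →ₗ[R] MvPolynomial τ R :=
    homogeneousComponent n ∘ₗ weightedHomogeneousComponent w 0
  change π q ∈ N
  have mem_of_monomial_mul (m : τ →₀ ℕ) (r : R) {p : MvPolynomial τ R} (hp : p ∈ s) :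
      π (monomial m r * p) ∈ N := by
    obtain ⟨k, hk, hpk⟩ := hs p hp
    -- A cofactor of `p` contributes only if it has weight `0` and degree `n - k < n`.
    change homogeneousComponent n (weightedHomogeneousComponent w 0 _) ∈ N
    rw [weightedHomogeneousComponent_of_mem
      ((isWeightedHomogeneous_monomial w m r rfl).mul (hB (hsB hp)))]
    split_ifs with hm
    · rw [homogeneousComponent_of_mem ((isHomogeneous_monomial r rfl).mul hpk)]
      split_ifs with hn
      · have hmN : monomial m 1 ∈ N := hN m (by lia) (by simpa using hm.symm)
        rw [← mul_one r, ← smul_eq_mul r, ← smul_monomial, mul_comm, mul_smul_comm]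
        exact N.smul_of_tower_mem r (N.smul_mem ⟨p, hsB hp⟩ hmN)
      · exact N.zero_mem
    · rw [map_zero]
      exact N.zero_mem
  induction hq using Submodule.closure_induction with
  | zero => simp
  | add x y _ _ hx hy => rw [map_add]; exact N.add_mem hx hy
  | smul_mem c p hp =>
    rw [smul_eq_mul]
    induction c using MvPolynomial.induction_on' with
    | monomial m r => exact mem_of_monomial_mul m r hp
    | add a b ha hb => rw [add_mul, map_add]; exact N.add_mem ha hb

theorem monomial_mem_span_of_weight_eq_zero {s : Set (MvPolynomial τ R)}
    (hB : B ≤ weightZeroSubalgebra R w) (hsB : s ⊆ B)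
    (hs : ∀ p ∈ s, ∃ k, 0 < k ∧ p.IsHomogeneous k) {m : τ →₀ ℕ} (hm : Finsupp.weight w m = 0) :
    monomial m (1 : R) ∈ Submodule.span B
      ((monomial · (1 : R)) '' {m | Finsupp.weight w m = 0 ∧ monomial m 1 ∉ Ideal.span s}) := by
  induction hn : m.degree using Nat.strong_induction_on generalizing m with
  | _ n ih =>
    by_cases hmJ : monomial m 1 ∈ Ideal.span s
    · have h := homogeneousComponent_weightedHomogeneousComponent_mem_of_mem_span hB hsB hs
        (fun m' hlt hm' => ih _ hlt hm' rfl) hmJ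
      rwa [(isWeightedHomogeneous_monomial w m 1 hm).weightedHomogeneousComponent_same,
        homogeneousComponent_of_mem (isHomogeneous_monomial 1 hn), if_pos rfl] at h
    · exact Submodule.subset_span ⟨m, ⟨hm, hmJ⟩, rfl⟩

theorem fg_range_reynolds [Finite τ] [IsNoetherianRing R] {s : Set (MvPolynomial τ R)}
    (hB : B ≤ weightZeroSubalgebra R w) (hsB : s ⊆ B)
    (hs : ∀ p ∈ s, ∃ k, 0 < k ∧ p.IsHomogeneous k)
    (hrad : ∀ m, m ≠ 0 → Finsupp.weight w m = 0 → monomial m 1 ∈ (Ideal.span s).radical) :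
    (reynolds hB).range.FG := by
  classical
  refine Submodule.fg_def.mpr ⟨(monomial · (1 : R)) '' _,
    (finite_setOf_monomial_notMem hrad).image _, le_antisymm ?_ ?_⟩
  · rw [Submodule.span_le]
    rintro _ ⟨m, ⟨hm, -⟩, rfl⟩
    exact ⟨monomial m 1,
      (isWeightedHomogeneous_monomial w m 1 hm).weightedHomogeneousComponent_same⟩
  · rintro _ ⟨q, rfl⟩
    change weightedHomogeneousComponent w 0 q ∈ _
    rw [weightedHomogeneousComponent_apply]
    refine Submodule.sum_mem _ fun m hm => ?_
    have hm0 : Finsupp.weight w m = 0 := (Finset.mem_filter.mp hm).2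
    rw [← mul_one (coeff m q), ← smul_eq_mul, ← smul_monomial]
    exact Submodule.smul_of_tower_mem _ _ (monomial_mem_span_of_weight_eq_zero hB hsB hs hm0)

end WeightZero

section Image

variable {σ τ K : Type*} [Field K]

theorem range_aeval_eq_zeroLocus_ker [IsAlgClosed K] [Finite τ] (f : σ → MvPolynomial τ K)
    {π : MvPolynomial τ K →ₗ[(aeval f : MvPolynomial σ K →ₐ[K] _).range] MvPolynomial τ K}
    (hπ1 : π 1 = 1) (hπ : π.range.FG) :
    Set.range (fun (a : τ → K) i => aeval a (f i)) =
      zeroLocus K (RingHom.ker (aeval f : MvPolynomial σ K →ₐ[K] _)) := by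
  let φ : MvPolynomial σ K →ₐ[K] MvPolynomial τ K := aeval f
  have aeval_comp (a : τ → K) (q : MvPolynomial σ K) :
      aeval a (φ q) = aeval (fun i => aeval a (f i)) q :=
    comp_aeval_apply f (aeval a) q
  ext p
  constructor
  · rintro ⟨a, rfl⟩ q hq
    rw [← aeval_comp, show φ q = 0 from hq, map_zero]
  · intro hp
    have ker_le : RingHom.ker φ ≤ vanishingIdeal K {p} :=
      fun q hq => (mem_vanishingIdeal_singleton_iff p q).mpr (hp q hq)
    have map_ne_top : (vanishingIdeal K {p}).map φ ≠ ⊤ :=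
      map_ne_top_of_fg_range (φ := φ) hπ1 hπ ker_le (Ideal.IsPrime.ne_top inferInstance)
    obtain ⟨Q, hQ, hle⟩ := Ideal.exists_le_maximal _ map_ne_top
    obtain ⟨a, rfl⟩ := isMaximal_iff_eq_vanishingIdeal_singleton.mp hQ
    refine ⟨a, funext fun i => ?_⟩
    have hX : X i - C (p i) ∈ vanishingIdeal K {p} := by simp
    have h := hle (Ideal.mem_map_of_mem φ hX)
    rw [mem_vanishingIdeal_singleton_iff, aeval_comp] at h
    simpa [sub_eq_zero] using h

end Image

section PrincipalMinor

variable {ι R S : Type*} [DecidableEq ι] [CommRing R] [CommRing S]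

theorem det_ne_zero_of_forall_ne_zero_iff_eq_perm [Fintype ι] [IsDomain R] {A : Matrix ι ι R}
    {σ : Equiv.Perm ι} (h : ∀ i j, A i j ≠ 0 ↔ j = σ i) : A.det ≠ 0 := by
  have permuted_eq : A.submatrix id σ = Matrix.diagonal fun i => A i (σ i) := by
    ext i j
    rcases eq_or_ne i j with rfl | hij
    · simp
    · rw [Matrix.diagonal_apply_ne _ hij]
      exact not_not.mp fun h0 => hij (σ.injective ((h i (σ j)).mp h0)).symm
  have permuted_det_ne : (A.submatrix id σ).det ≠ 0 := by
    rw [permuted_eq, Matrix.det_diagonal]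
    exact Finset.prod_ne_zero_iff.mpr fun i _ => (h i (σ i)).mpr rfl
  rw [Matrix.det_permute'] at permuted_det_ne
  exact right_ne_zero_of_mul permuted_det_ne

/-- The principal minor of `A` with rows and columns in `I`, for matrices over any commutative ring;
`affinePrincipalMinorMap n` is the case of complex matrices indexed by `Fin n`. -/
def principalMinor (A : Matrix ι ι R) (I : Finset ι) : R :=
  (A.submatrix (Subtype.val : I → ι) (Subtype.val : I → ι)).det

theorem map_principalMinor (φ : R →+* S) (A : Matrix ι ι R) (I : Finset ι) :
    φ (principalMinor A I) = principalMinor (A.map φ) I :=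
  φ.map_det _

theorem exists_nonempty_principalMinor_ne_zero [IsDomain R] {A : Matrix ι ι R} {s : Finset ι}
    (hs : IsSinkFree (fun i j => A i j ≠ 0) s) :
    ∃ I : Finset ι, I.Nonempty ∧ principalMinor A I ≠ 0 := by
  obtain ⟨I, -, hI⟩ := exists_minimal_le_of_wellFoundedLT _ s hs
  obtain ⟨σ, hσ⟩ := IsSinkFree.exists_perm_of_minimal hI
  exact ⟨I, hI.prop.1, det_ne_zero_of_forall_ne_zero_iff_eq_perm hσ⟩

/-- The weight of the coordinate function of the `e`-th matrix entry under the torus of diagonal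
matrices acting by conjugation; the torus-invariant polynomials are those of weight `0`. -/
def torusWeight (e : ι × ι) : ι → ℤ :=
  Pi.single e.1 1 - Pi.single e.2 1

theorem weight_torusWeight_apply [Fintype ι] (m : ι × ι →₀ ℕ) (i : ι) :
    Finsupp.weight torusWeight m i = ∑ j, (m (i, j) : ℤ) - ∑ j, (m (j, i) : ℤ) := by
  simp [Finsupp.weight_apply, Finsupp.sum_fintype, Fintype.sum_prod_type, torusWeight,
    Pi.single_apply, mul_sub, Finset.sum_sub_distrib, Finset.sum_comm (γ := ι)]

theorem isSinkFree_of_weight_torusWeight_eq_zero [Fintype ι] {m : ι × ι →₀ ℕ}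
    (hm : Finsupp.weight torusWeight m = 0) (hm0 : m ≠ 0) :
    IsSinkFree (fun i j => m (i, j) ≠ 0) {i | ∃ j, m (i, j) ≠ 0} := by
  constructor
  · obtain ⟨⟨i, j⟩, hij⟩ := Finsupp.ne_iff.mp hm0
    exact ⟨i, by simpa using ⟨j, hij⟩⟩
  · intro i hi
    obtain ⟨j, hij⟩ := (Finset.mem_filter.mp hi).2
    have in_ne_zero : ∑ k, m (k, j) ≠ 0 :=
      fun h => hij (Finset.sum_eq_zero_iff.mp h i (Finset.mem_univ i))
    have out_eq_in : ∑ k, m (j, k) = ∑ k, m (k, j) := by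
      have h := congrFun hm j
      rw [weight_torusWeight_apply, Pi.zero_apply, sub_eq_zero] at h
      exact_mod_cast h
    obtain ⟨k, -, hjk⟩ := Finset.exists_ne_zero_of_sum_ne_zero (out_eq_in ▸ in_ne_zero)
    exact ⟨j, by simpa using ⟨k, hjk⟩, hij⟩

variable (ι R) in
/-- The principal minors of the generic matrix, as polynomials in the matrix entries. -/
noncomputable def genericPrincipalMinor (I : Finset ι) : MvPolynomial (ι × ι) R :=
  principalMinor (Matrix.mvPolynomialX ι ι R) I

theorem aeval_genericPrincipalMinor (A : Matrix ι ι R) (I : Finset ι) :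
    aeval (fun e : ι × ι => A e.1 e.2) (genericPrincipalMinor ι R I) = principalMinor A I := by
  rw [genericPrincipalMinor, ← RingHom.coe_coe, map_principalMinor]
  congr 1
  ext i j
  simp

theorem isWeightedHomogeneous_genericPrincipalMinor {M : Type*} [AddCommMonoid M]
    {w : ι × ι → M} {u v : ι → M} (hw : ∀ i j, w (i, j) = u i + v j) (I : Finset ι) :
    IsWeightedHomogeneous w (genericPrincipalMinor ι R I) (∑ i ∈ I, (u i + v i)) := by
  rw [genericPrincipalMinor, principalMinor, Matrix.det_apply]
  refine IsWeightedHomogeneous.sum _ _ _ fun σ _ =>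
    (weightedHomogeneousSubmodule R w _).smul_of_tower_mem _ ?_
  have weight_eq : ∑ i : I, w (σ i, i) = ∑ i ∈ I, (u i + v i) := by
    simp only [hw, Finset.sum_add_distrib]
    rw [Equiv.sum_comp σ fun i : I => u i, Finset.sum_coe_sort I u, Finset.sum_coe_sort I v]
  rw [← weight_eq]
  exact IsWeightedHomogeneous.prod _ _ _ fun i _ => isWeightedHomogeneous_X R w _

theorem isHomogeneous_genericPrincipalMinor (I : Finset ι) :
    (genericPrincipalMinor ι R I).IsHomogeneous I.card := by
  simpa using! isWeightedHomogeneous_genericPrincipalMinor (R := R) (w := 1) (u := 1)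
    (v := (0 : ι → ℕ)) (fun _ _ => rfl) I

theorem isWeightedHomogeneous_torusWeight_genericPrincipalMinor (I : Finset ι) :
    IsWeightedHomogeneous torusWeight (genericPrincipalMinor ι R I) 0 := by
  simpa using isWeightedHomogeneous_genericPrincipalMinor (R := R) (w := torusWeight)
    (u := fun i => Pi.single i 1) (v := fun j => -Pi.single j 1) (fun _ _ => sub_eq_add_neg _ _) I

theorem monomial_mem_radical_span_genericPrincipalMinor [Finite ι] {m : ι × ι →₀ ℕ} (hm0 : m ≠ 0)
    (hm : Finsupp.weight torusWeight m = 0) :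
    monomial m 1 ∈ (Ideal.span (genericPrincipalMinor ι R '' {I | I.Nonempty})).radical := by
  have := Fintype.ofFinite ι
  rw [Ideal.radical_eq_sInf, Submodule.mem_sInf]
  rintro Q ⟨hQ, hprime⟩
  by_contra hmQ
  let A : Matrix ι ι (MvPolynomial (ι × ι) R ⧸ Q) :=
    (Matrix.mvPolynomialX ι ι R).map (Ideal.Quotient.mk Q)
  have entry_ne_zero (i j : ι) (hij : m (i, j) ≠ 0) : A i j ≠ 0 := by
    refine fun hA => hmQ (Ideal.mem_of_dvd Q (X_dvd_monomial.mpr (Or.inr hij)) ?_)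
    exact Ideal.Quotient.eq_zero_iff_mem.mp hA
  obtain ⟨I, hI, hne⟩ := exists_nonempty_principalMinor_ne_zero
    ((isSinkFree_of_weight_torusWeight_eq_zero hm hm0).mono entry_ne_zero)
  rw [← map_principalMinor] at hne
  exact hne (Ideal.Quotient.eq_zero_iff_mem.mpr (hQ (Ideal.subset_span ⟨I, hI, rfl⟩)))

theorem range_aeval_genericPrincipalMinor_le_weightZeroSubalgebra :
    (aeval (genericPrincipalMinor ι R) : MvPolynomial (Finset ι) R →ₐ[R] _).range ≤
      weightZeroSubalgebra R torusWeight := by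
  rw [← Algebra.adjoin_range_eq_range_aeval, Algebra.adjoin_le_iff]
  rintro _ ⟨I, rfl⟩
  exact isWeightedHomogeneous_torusWeight_genericPrincipalMinor I

theorem range_principalMinor_eq_zeroLocus {K : Type*} [Field K] [IsAlgClosed K] [Finite ι] :
    Set.range (principalMinor : Matrix ι ι K → Finset ι → K) =
      zeroLocus K (RingHom.ker
        (aeval (genericPrincipalMinor ι K) : MvPolynomial (Finset ι) K →ₐ[K] _)) := by
  have invariant := range_aeval_genericPrincipalMinor_le_weightZeroSubalgebra (ι := ι) (R := K)
  have finite : (reynolds invariant).range.FG := by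
    refine fg_range_reynolds (s := genericPrincipalMinor ι K '' {I | I.Nonempty}) invariant ?_ ?_
      fun m hm0 hm => monomial_mem_radical_span_genericPrincipalMinor hm0 hm
    · rintro _ ⟨I, -, rfl⟩
      exact ⟨X I, aeval_X _ I⟩
    · rintro _ ⟨I, hI, rfl⟩
      exact ⟨I.card, hI.card_pos, isHomogeneous_genericPrincipalMinor I⟩
  rw [← range_aeval_eq_zeroLocus_ker (genericPrincipalMinor ι K) (reynolds_one invariant) finite,
    ← (Equiv.curry ι ι K).symm.surjective.range_comp]
  exact congrArg Set.range (funext₂ fun A I => (aeval_genericPrincipalMinor A I).symm)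

end PrincipalMinor

theorem isClosed_zeroLocus {σ K : Type*} [Field K] [TopologicalSpace K] [IsTopologicalSemiring K]
    [T1Space K] (J : Ideal (MvPolynomial σ K)) : IsClosed (zeroLocus K J) := by
  have zeroLocus_eq : zeroLocus K J = ⋂ p ∈ J, (fun x => eval x p) ⁻¹' {0} := by
    ext x
    simp [mem_zeroLocus_iff, aeval_eq_eval]
  rw [zeroLocus_eq]
  exact isClosed_biInter fun p _ => isClosed_singleton.preimage (continuous_eval p)

theorem theorem1_general {ι K : Type*} [Finite ι] [DecidableEq ι] [Field K] [IsAlgClosed K]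
    [TopologicalSpace K] [IsTopologicalSemiring K] [T1Space K] :
    IsClosed (Set.range (principalMinor : Matrix ι ι K → Finset ι → K)) ∧
      ∃ J : Ideal (MvPolynomial (Finset ι) K),
        Set.range (principalMinor : Matrix ι ι K → Finset ι → K) = zeroLocus K J := by
  rw [range_principalMinor_eq_zeroLocus]
  exact ⟨isClosed_zeroLocus _, _, rfl⟩

theorem theorem1 (n : ℕ) :
    IsClosed (Set.range (affinePrincipalMinorMap n)) ∧
      ∃ J : Ideal (MvPolynomial (Finset (Fin n)) ℂ),
        Set.range (affinePrincipalMinorMap n) = MvPolynomial.zeroLocus ℂ J :=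
  theorem1_general
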